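/- **Setting.** Let $G=(V,E)$ be a finite simple undirected graph. Write $A_G$ for its adjacency matrix, $D$ for the diagonal matrix of its degrees, and $H_G$ for its Hashimoto non-backtracking matrix: it is indexed by the oriented edges of $G$, and for $e=(u,w)$, $f=(z,y)$ we have $H_G(e,f)=1$ if $w=z$ and $u\neq y$, and $H_G(e,f)=0$ otherwise. For a real square matrix $M$, $\rho(M)$ denotes its spectral radius, i.e. the largest modulus of a complex eigenvalue of $M$, and $\|M\|_2$ denotes the operator norm induced by the Euclidean norm. Let $0\le\beta\le\gamma$, $\gamma>0$, $\lambda>0$. The Gibbs distribution $\mu_G$ on $\{\pm1\}^V$ with parameters $(\beta,\gamma,\lambda)$ is $$\mu_G(\sigma)\ \propto\ \lambda^{\#\{v\,:\,\sigma(v)=1\}}\;\beta^{\#\{\text{edges with both ends }1\}}\;\gamma^{\#\{\text{edges with both ends }-1\}} .$$ For $\Lambda\subseteq V$ and $\tau\in\{\pm1\}^\Lambda$, the pairwise influence matrix $\mathcal I^{\Lambda,\tau}_G$ is indexed by $V\setminus\Lambda$ and has the entries $$\mathcal I^{\Lambda,\tau}_G(w,u)=\mu_G\big(\sigma(u)=1\mid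 \sigma|_\Lambda=\tau,\ \sigma(w)=1\big)-\mu_G\big(\sigma(u)=1\mid \sigma|_\Lambda=\tau,\ \sigma(w)=-1\big).$$ For $d\ge 1$ let $$H_d(x_1,\dots,x_d)=\log\lambda+\sum_{i=1}^d\log\frac{\beta e^{x_i}+1}{e^{x_i}+\gamma},$$ with gradient $\nabla H_d$, extended by continuity to $[-\infty,+\infty]^d$. For $\delta\ge0$ and an integer $\Delta\ge1$, the set $\{H_d\}_{1\le d\le\Delta}$ exhibits $\delta$-contraction if $\|\nabla H_d(y)\|_\infty\le\delta$ for all $1\le d\le\Delta$ and all $y\in[-\infty,+\infty]^d$. **Theorem 5.3.** Let $\Delta\ge1$ be an integer, $\nu_G\ge1$, $\varepsilon\in(0,1)$, and let $\beta,\gamma,\lambda\in\mathbb R$ satisfy $0\le\beta\le\gamma$, $\gamma>0$, $\lambda>0$. Suppose that $G$ has maximum degree $\Delta$ and that $\rho(H_G)=\nu_G$. Put $\delta=\frac{1-\varepsilon}{\nu_G}$ and suppose that $\{H_d\}_{1\le d\le\Delta}$, defined with respect to $(\beta,\gamma,\lambda)$, exhibits $\delta$-contraction. (This forces $\beta>0$,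 so that all the conditional probabilities above are well defined.) Then the matrix $I-\delta A_G+\delta^2(D-I)$ is invertible, and for every $\Lambda\subseteq V$ and every $\tau\in\{\pm1\}^\Lambda$, $$\rho\big(\mathcal I^{\Lambda,\tau}_G\big)\ \le\ \Big\|\big(I-\delta A_G+\delta^2(D-I)\big)^{-1}\Big\|_2 .$$ (For $\Lambda=V$ the matrix $\mathcal I^{\Lambda,\tau}_G$ is empty and its spectral radius is taken to be $0$.) -/

import Mathlib

noncomputable section

namespace TwoSpin

open Real Filter Topology

/-! ### Log-ratio recursion and contraction -/

/-- The log-ratio recursion `H_d` at real arguments. -/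
def logRatio (β γ lam : ℝ) (d : ℕ) (x : Fin d → ℝ) : ℝ :=
  log lam + ∑ i, log ((β * exp (x i) + 1) / (exp (x i) + γ))

/-- The gradient of `H_d` at a real point: the vector of its partial derivatives. -/
def gradReal (β γ lam : ℝ) (d : ℕ) (x : Fin d → ℝ) : Fin d → ℝ :=
  fun i => deriv (fun t => logRatio β γ lam d (Function.update x i t)) (x i)

/-- The gradient of `H_d` at a point of `[-∞, +∞]^d`: the limit of the gradients at real points.
`grad_eq` below shows that this limit exists and gives its value. -/
def grad (β γ lam : ℝ) (d : ℕ) (y : Fin d → EReal) : Fin d → ℝ :=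
  limUnder (comap (fun (x : Fin d → ℝ) (i : Fin d) => (x i : EReal)) (𝓝 y)) (gradReal β γ lam d)

/-- `δ`-contraction of `{H_d}`, `1 ≤ d ≤ Δ`. The norm on `Fin d → ℝ` is the sup norm. -/
def Contraction (δ : ℝ) (Δ : ℕ) (β γ lam : ℝ) : Prop :=
  ∀ d : ℕ, 1 ≤ d → d ≤ Δ → ∀ y : Fin d → EReal, ‖grad β γ lam d y‖ ≤ δ

/-- The common partial derivative `h`, on the reals. -/
def hReal (β γ x : ℝ) : ℝ :=
  -((1 - β * γ) * exp x) / ((β * exp x + 1) * (exp x + γ))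

/-- The function `h` on `[-∞, +∞]`, by continuity at the two ends. -/
def h (β γ : ℝ) : EReal → ℝ
  | ⊥ => 0
  | ⊤ => if β = 0 then -1 else 0
  | (x : ℝ) => hReal β γ x

lemma hasDerivAt_summand {β γ : ℝ} (hβ : 0 ≤ β) (hγ : 0 < γ) (x : ℝ) :
    HasDerivAt (fun t => log ((β * exp t + 1) / (exp t + γ))) (hReal β γ x) x := by
  have h1 : 0 < β * exp x + 1 := by positivity
  have h2 : 0 < exp x + γ := by positivity
  have e := Real.hasDerivAt_exp x
  have := (((e.const_mul β).add_const 1).div (e.add_const γ) h2.ne').log (div_pos h1 h2).ne'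
  refine this.congr_deriv ?_
  simp only [hReal, Pi.div_apply]
  field_simp
  ring

lemma gradReal_eq {β γ lam : ℝ} (hβ : 0 ≤ β) (hγ : 0 < γ) (d : ℕ) (x : Fin d → ℝ) :
    gradReal β γ lam d x = fun i => hReal β γ (x i) := by
  funext i
  have hf : ∀ t, logRatio β γ lam d (Function.update x i t) =
      log ((β * exp t + 1) / (exp t + γ)) + (log lam +
        ∑ j ∈ Finset.univ.erase i, log ((β * exp (x j) + 1) / (exp (x j) + γ))) := by
    intro t
    unfold logRatio
    rw [← Finset.add_sum_erase _ _ (Finset.mem_univ i)]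
    have : ∀ j ∈ Finset.univ.erase i, log ((β * exp (Function.update x i t j) + 1) /
        (exp (Function.update x i t j) + γ)) = log ((β * exp (x j) + 1) / (exp (x j) + γ)) := by
      intro j hj
      rw [Function.update_of_ne (Finset.ne_of_mem_erase hj)]
    rw [Finset.sum_congr rfl this, Function.update_self]
    ring
  unfold gradReal
  simp_rw [hf]
  exact ((hasDerivAt_summand hβ hγ (x i)).add_const _).deriv

lemma tendsto_h {β γ : ℝ} (hβ : 0 ≤ β) (hγ : 0 < γ) (y : EReal) :
    Tendsto (hReal β γ) (comap ((↑) : ℝ → EReal) (𝓝 y)) (𝓝 (h β γ y)) := by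
  induction y with
  | bot =>
    have hc : comap ((↑) : ℝ → EReal) (𝓝 ⊥) ≤ atBot := by
      rw [atBot_basis.ge_iff]
      intro a _
      refine ⟨Set.Iio (a : EReal), Iio_mem_nhds (EReal.bot_lt_coe a), fun z hz => ?_⟩
      exact (EReal.coe_lt_coe_iff.1 hz).le
    refine Tendsto.mono_left ?_ hc
    have e := Real.tendsto_exp_atBot
    have := ((e.const_mul (1 - β * γ)).neg).div
      (((e.const_mul β).add_const 1).mul (e.add_const γ)) (by simpa using hγ.ne')
    simp only [mul_zero, neg_zero, zero_div] at this
    exact this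
  | top =>
    have hc : comap ((↑) : ℝ → EReal) (𝓝 ⊤) ≤ atTop := by
      rw [atTop_basis.ge_iff]
      intro a _
      refine ⟨Set.Ioi (a : EReal), Ioi_mem_nhds (EReal.coe_lt_top a), fun z hz => ?_⟩
      exact (EReal.coe_lt_coe_iff.1 hz).le
    refine Tendsto.mono_left ?_ hc
    have e : Tendsto (fun x : ℝ => exp (-x)) atTop (𝓝 0) := Real.tendsto_exp_neg_atTop_nhds_zero
    by_cases h0 : β = 0
    · subst h0
      have := ((tendsto_const_nhds (x := (-1 : ℝ))).div
        ((e.const_mul γ).const_add 1) (by simp))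
      simp only [mul_zero, add_zero, div_one] at this
      simp only [h, if_true]
      refine this.congr fun x => ?_
      have : 0 < exp x := exp_pos x
      simp only [hReal, exp_neg, Pi.div_apply]
      field_simp
      ring
    · have := ((e.const_mul (1 - β * γ)).neg).div
        ((e.const_add β).mul ((e.const_mul γ).const_add 1)) (by simpa using h0)
      simp only [mul_zero, add_zero, neg_zero, zero_div] at this
      simp only [h, h0, if_false]
      refine this.congr fun x => ?_
      have : 0 < exp x := exp_pos x
      simp only [hReal, exp_neg, Pi.div_apply]
      field_simp
  | coe x =>
    rw [← EReal.isEmbedding_coe.nhds_eq_comap]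
    have hc : Continuous (hReal β γ) := by
      unfold hReal
      refine Continuous.div (by fun_prop) (by fun_prop) fun t => ?_
      have := exp_pos t
      positivity
    exact hc.tendsto x

/-- The gradient of `H_d` on `[-∞, +∞]^d` has the coordinates `h (y i)`. -/
theorem grad_eq {β γ lam : ℝ} (hβ : 0 ≤ β) (hγ : 0 < γ) (d : ℕ) (y : Fin d → EReal) :
    grad β γ lam d y = fun i => h β γ (y i) := by
  have hd : DenseRange (fun (x : Fin d → ℝ) (i : Fin d) => (x i : EReal)) :=
    DenseRange.piMap fun _ => by
      refine dense_of_exists_between fun a b hab => ?_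
      obtain ⟨c, hac, hcb⟩ := EReal.lt_iff_exists_real_btwn.1 hab
      exact ⟨c, ⟨c, rfl⟩, hac, hcb⟩
  have : NeBot (comap (fun (x : Fin d → ℝ) (i : Fin d) => (x i : EReal)) (𝓝 y)) :=
    comap_neBot fun s hs => by
      obtain ⟨_, hz, a, rfl⟩ := mem_closure_iff_nhds.1 (hd y) s hs
      exact ⟨a, hz⟩
  refine Tendsto.limUnder_eq ?_
  rw [tendsto_pi_nhds]
  intro i
  simp_rw [gradReal_eq hβ hγ]
  refine (tendsto_h hβ hγ (y i)).comp ?_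
  rw [tendsto_comap_iff]
  exact ((continuous_apply i).tendsto y).comp tendsto_comap

/-! ### The Gibbs distribution and the influence matrix -/

section Gibbs

variable {V : Type*} [Fintype V] [DecidableEq V] (G : SimpleGraph V) [DecidableRel G.Adj]

/-- The unnormalized Gibbs weight of a configuration; the group of units `ℤˣ` is `{1, -1}`. -/
def weight (β γ lam : ℝ) (σ : V → ℤˣ) : ℝ :=
  lam ^ (Finset.univ.filter fun v => σ v = 1).card *
  β ^ (G.edgeFinset.filter fun e => ∀ v ∈ e, σ v = 1).card *
  γ ^ (G.edgeFinset.filter fun e => ∀ v ∈ e, σ v = -1).card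

/-- The Gibbs distribution `μ_G`. -/
def gibbs (β γ lam : ℝ) (σ : V → ℤˣ) : ℝ :=
  weight G β γ lam σ / ∑ σ' : V → ℤˣ, weight G β γ lam σ'

/-- The conditional probability `μ_G(A | B)`. -/
def condProb (β γ lam : ℝ) (A B : Finset (V → ℤˣ)) : ℝ :=
  (∑ σ ∈ A ∩ B, gibbs G β γ lam σ) / ∑ σ ∈ B, gibbs G β γ lam σ

/-- The event that the configuration at `Λ` is `τ`. -/
def pinned (Λ : Finset V) (τ : Λ → ℤˣ) : Finset (V → ℤˣ) :=
  Finset.univ.filter fun σ => ∀ v : Λ, σ v = τ v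

/-- The event that vertex `v` has spin `s`. -/
def spinAt (v : V) (s : ℤˣ) : Finset (V → ℤˣ) :=
  Finset.univ.filter fun σ => σ v = s

/-- The pairwise influence matrix, indexed by the vertices outside `Λ`. -/
def influence (β γ lam : ℝ) (Λ : Finset V) (τ : Λ → ℤˣ) :
    Matrix {v : V // v ∉ Λ} {v : V // v ∉ Λ} ℝ :=
  Matrix.of fun w u =>
    condProb G β γ lam (spinAt u.1 1) (pinned Λ τ ∩ spinAt w.1 1) -
    condProb G β γ lam (spinAt u.1 1) (pinned Λ τ ∩ spinAt w.1 (-1))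

end Gibbs

/-! ### Matrices -/

/-- The Hashimoto non-backtracking matrix, indexed by the oriented edges of `G`. -/
def hashimoto {V : Type*} [DecidableEq V] (G : SimpleGraph V) : Matrix G.Dart G.Dart ℝ :=
  Matrix.of fun e f => if e.snd = f.fst ∧ e.fst ≠ f.snd then 1 else 0

/-- The spectral radius of a real square matrix: the largest modulus of its complex eigenvalues
(`0` for the empty matrix). -/
def rho {n : Type*} [Fintype n] [DecidableEq n] (M : Matrix n n ℝ) : ℝ :=
  (spectralRadius ℂ (M.map ((↑) : ℝ → ℂ))).toReal

/-- The matrix `I - δ A_G + δ² (D - I)`. -/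
def iharaMatrix {V : Type*} [Fintype V] [DecidableEq V] (G : SimpleGraph V) [DecidableRel G.Adj]
    (δ : ℝ) : Matrix V V ℝ :=
  1 - δ • G.adjMatrix ℝ + δ ^ 2 • (G.degMatrix ℝ - 1)

/-- The matrix norm induced by the Euclidean norm. -/
def norm2 {n : Type*} [Fintype n] [DecidableEq n] (M : Matrix n n ℝ) : ℝ :=
  ‖Matrix.toEuclideanCLM (𝕜 := ℝ) M‖

end TwoSpin

end

set_option linter.unusedSectionVars false

noncomputable section

namespace TwoSpin

/-! ### Two-spin systems with vertex-dependent fields -/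

/-! The influence of `w` on `u` obeys a recursion under vertex deletion. Once the spin of `w` is
fixed, its edges act only as external fields on its neighbours, so passing from spin $-1$ to spin
$1$ at `w` changes the fields of the neighbours in a system without `w`. Switching them one at a
time, each switch at `v` changes the marginal of `u` by the influence of `v` on `u` in the smaller
system, times a value of $h$ of modulus at most $\delta$ (`abs_marginal_sub_le`). Hence $|I(w,u)|
\le \delta \sum_v |I'(v,u)|$ (`abs_fieldInfluence_le`). Working uniformly over all admissible
fields, point masses included, closes the induction and covers pinnings; no tree of self-avoiding
walks is needed.

Iterating follows walks that never return to a deleted vertex, in particular non-backtracking walks.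
The influence matrix is therefore dominated entrywise by their generating function $W$, which
converges because $\delta\rho(H_G) < 1$ (`abs_fieldInfluence_le_of_dart`,
`exists_nonneg_resolvent`). The Ihara–Bass identity gives $W = (1-\delta^2)(I-\delta
A_G+\delta^2(D-I))^{-1}$ (`iharaMatrix_mul_walkMatrix`). Entrywise domination then bounds the
spectral radius by the Euclidean norm (`rho_le_norm2`). -/

/-- The weight of a pair of adjacent spins. -/
def pairWeight (β γ : ℝ) (s t : ℤˣ) : ℝ :=
  if s = t then (if s = 1 then β else γ) else 1

lemma pairWeight_comm (β γ : ℝ) (s t : ℤˣ) : pairWeight β γ s t = pairWeight β γ t s := by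
  unfold pairWeight
  by_cases hst : s = t
  · simp [hst]
  · simp [hst, Ne.symm hst]

lemma pairWeight_pos {β γ : ℝ} (hβ : 0 < β) (hγ : 0 < γ) (s t : ℤˣ) :
    0 < pairWeight β γ s t := by
  unfold pairWeight
  split_ifs <;> first | assumption | exact one_pos

/-- The weight of an edge in a configuration. -/
def edgeWeight {V : Type*} (β γ : ℝ) (σ : V → ℤˣ) (e : Sym2 V) : ℝ :=
  Sym2.lift ⟨fun a b => pairWeight β γ (σ a) (σ b), fun _ _ => pairWeight_comm _ _ _ _⟩ e

lemma edgeWeight_mk {V : Type*} (β γ : ℝ) (σ : V → ℤˣ) (a b : V) :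
    edgeWeight β γ σ s(a, b) = pairWeight β γ (σ a) (σ b) := rfl

/-- The field that forces the spin `s`. -/
def pointField (s t : ℤˣ) : ℝ := if t = s then 1 else 0

/-- A field is admissible if it is nonnegative and allows at least one spin at each vertex. -/
def Admissible {V : Type*} (φ : V → ℤˣ → ℝ) : Prop :=
  ∀ v, (∀ s, 0 ≤ φ v s) ∧ ∃ s, 0 < φ v s

lemma Admissible.update {V : Type*} [DecidableEq V] {φ : V → ℤˣ → ℝ} (hφ : Admissible φ) (v : V)
    (s : ℤˣ) : Admissible (Function.update φ v (pointField s)) := by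
  intro x
  by_cases hx : x = v
  · subst hx
    simp only [Function.update_self]
    refine ⟨fun t => ?_, s, by simp [pointField]⟩
    unfold pointField
    split_ifs <;> norm_num
  · simpa only [Function.update_of_ne hx] using hφ x

section

variable {V : Type*} [Fintype V] [DecidableEq V] (G : SimpleGraph V) [DecidableRel G.Adj]

/-- The weight of a configuration in which only the edges inside `S` interact. -/
def fieldWeight (β γ : ℝ) (S : Finset V) (φ : V → ℤˣ → ℝ) (σ : V → ℤˣ) : ℝ :=
  (∏ v, φ v (σ v)) * ∏ e ∈ G.edgeFinset.filter (fun e => ∀ v ∈ e, v ∈ S), edgeWeight β γ σ e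

/-- The total weight of the configurations, each counted with the factor `F`. -/
def fieldSum (β γ : ℝ) (S : Finset V) (φ : V → ℤˣ → ℝ) (F : (V → ℤˣ) → ℝ) : ℝ :=
  ∑ σ, fieldWeight G β γ S φ σ * F σ

/-- The probability that `u` has spin `1`. -/
def marginal (β γ : ℝ) (S : Finset V) (φ : V → ℤˣ → ℝ) (u : V) : ℝ :=
  fieldSum G β γ S φ (fun σ => if σ u = 1 then 1 else 0) / fieldSum G β γ S φ 1

/-- The influence of forcing the spin of `v` on the marginal of `u`. -/
def fieldInfluence (β γ : ℝ) (S : Finset V) (φ : V → ℤˣ → ℝ) (v u : V) : ℝ :=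
  marginal G β γ S (Function.update φ v (pointField 1)) u -
    marginal G β γ S (Function.update φ v (pointField (-1))) u

variable {β γ : ℝ}

lemma fieldWeight_update (S : Finset V) (φ : V → ℤˣ → ℝ) (v : V) (f : ℤˣ → ℝ) (σ : V → ℤˣ) :
    fieldWeight G β γ S (Function.update φ v f) σ =
      f (σ v) * fieldWeight G β γ S (Function.update φ v 1) σ := by
  unfold fieldWeight
  rw [← mul_assoc, ← Finset.mul_prod_erase _ _ (Finset.mem_univ v),
    ← Finset.mul_prod_erase _ (fun x => Function.update φ v 1 x (σ x)) (Finset.mem_univ v)]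
  simp only [Function.update_self, Pi.one_apply, one_mul]
  congr 2
  refine Finset.prod_congr rfl fun x hx => ?_
  rw [Function.update_of_ne (Finset.ne_of_mem_erase hx),
    Function.update_of_ne (Finset.ne_of_mem_erase hx)]

/-- Linearity in the field at `v`: two point-field sums determine every marginal after a change of
that field. -/
lemma fieldSum_update (S : Finset V) (φ : V → ℤˣ → ℝ) (v : V) (f : ℤˣ → ℝ)
    (F : (V → ℤˣ) → ℝ) :
    fieldSum G β γ S (Function.update φ v f) F =
      f 1 * fieldSum G β γ S (Function.update φ v (pointField 1)) F +
      f (-1) * fieldSum G β γ S (Function.update φ v (pointField (-1))) F := by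
  unfold fieldSum
  rw [Finset.mul_sum, Finset.mul_sum, ← Finset.sum_add_distrib]
  refine Finset.sum_congr rfl fun σ _ => ?_
  rw [fieldWeight_update, fieldWeight_update G S φ v (pointField 1),
    fieldWeight_update G S φ v (pointField (-1))]
  rcases Int.units_eq_one_or (σ v) with hs | hs <;> rw [hs] <;>
    simp [pointField] <;> ring

lemma fieldSum_pos (hβ : 0 < β) (hγ : 0 < γ) (S : Finset V) {φ : V → ℤˣ → ℝ}
    (hφ : Admissible φ) : 0 < fieldSum G β γ S φ 1 := by
  have hE : ∀ σ : V → ℤˣ, 0 < ∏ e ∈ G.edgeFinset.filter (fun e => ∀ v ∈ e, v ∈ S),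
      edgeWeight β γ σ e := fun σ => Finset.prod_pos fun e _ => by
    induction e with
    | _ a b => exact pairWeight_pos hβ hγ _ _
  unfold fieldSum
  choose s hs using fun v => (hφ v).2
  refine Finset.sum_pos' (fun σ _ => ?_) ⟨s, Finset.mem_univ _, ?_⟩
  · simp only [Pi.one_apply, mul_one]
    exact mul_nonneg (Finset.prod_nonneg fun v _ => (hφ v).1 _) (hE σ).le
  · simp only [Pi.one_apply, mul_one]
    exact mul_pos (Finset.prod_pos fun v _ => hs v) (hE s)

/-- The quantity is $h(\log(X/Y))$. In the application `X` and `Y` are the total weights with spin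
$1$ and $-1$ at a vertex; one of them vanishes if the field forces the spin, and then so does the
quantity. -/
lemma abs_sub_le_of_contraction {δ : ℝ} (hβ : 0 < β) (hγ : 0 < γ)
    (hh : ∀ x, |hReal β γ x| ≤ δ) {X Y : ℝ} (hX : 0 ≤ X) (hY : 0 ≤ Y) :
    |(β * γ - 1) * X * Y / ((β * X + Y) * (X + γ * Y))| ≤ δ := by
  have h0 : 0 ≤ δ := (abs_nonneg _).trans (hh 0)
  rcases hX.eq_or_lt with rfl | hX
  · simpa using h0
  rcases hY.eq_or_lt with rfl | hY
  · simpa using h0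
  refine le_trans (le_of_eq ?_) (hh (Real.log (X / Y)))
  unfold hReal
  rw [Real.exp_log (div_pos hX hY)]
  congr 1
  field_simp
  ring

/-- The effect of a change of the field at one vertex. -/
lemma abs_marginal_sub_le {δ : ℝ} (hβ : 0 < β) (hγ : 0 < γ) (hh : ∀ x, |hReal β γ x| ≤ δ)
    (S : Finset V) {φ : V → ℤˣ → ℝ} (hφ : Admissible φ) (v u : V) {f : ℤˣ → ℝ}
    (hf : ∀ s, 0 ≤ f s) (hf' : ∃ s, 0 < f s) :
    |marginal G β γ S (Function.update φ v fun t => f t * pairWeight β γ 1 t) u -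
      marginal G β γ S (Function.update φ v fun t => f t * pairWeight β γ (-1) t) u| ≤
    δ * |fieldInfluence G β γ S φ v u| := by
  have hp := fieldSum_pos G hβ hγ S (hφ.update v 1)
  have hm := fieldSum_pos G hβ hγ S (hφ.update v (-1))
  unfold fieldInfluence marginal
  simp only [fieldSum_update G S φ v fun t => f t * pairWeight β γ _ t]
  have e1 : pairWeight β γ 1 1 = β := by simp [pairWeight]
  have e2 : pairWeight β γ 1 (-1) = 1 := by simp [pairWeight]
  have e3 : pairWeight β γ (-1) 1 = 1 := by simp [pairWeight]
  have e4 : pairWeight β γ (-1) (-1) = γ := by simp [pairWeight]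
  rw [e1, e2, e3, e4]
  generalize fieldSum G β γ S (Function.update φ v (pointField 1)) 1 = Zp at *
  generalize fieldSum G β γ S (Function.update φ v (pointField (-1))) 1 = Zm at *
  generalize fieldSum G β γ S (Function.update φ v (pointField 1)) _ = Qp at *
  generalize fieldSum G β γ S (Function.update φ v (pointField (-1))) _ = Qm at *
  have ha := hf 1
  have hb := hf (-1)
  have hab : 0 < f 1 ∨ 0 < f (-1) := by
    obtain ⟨s, hs⟩ := hf'
    rcases Int.units_eq_one_or s with rfl | rfl
    · exact Or.inl hs
    · exact Or.inr hs
  generalize f 1 = a at *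
  generalize f (-1) = b at *
  have key := abs_sub_le_of_contraction hβ hγ hh (mul_nonneg ha hp.le) (mul_nonneg hb hm.le)
  have d1 : 0 < β * (a * Zp) + b * Zm := by
    rcases hab with h | h
    · have := mul_pos hβ (mul_pos h hp); have := mul_nonneg hb hm.le; linarith
    · have := mul_pos h hm; have := mul_nonneg hβ.le (mul_nonneg ha hp.le); linarith
  have d2 : 0 < a * Zp + γ * (b * Zm) := by
    rcases hab with h | h
    · have := mul_pos h hp; have := mul_nonneg hγ.le (mul_nonneg hb hm.le); linarith
    · have := mul_pos hγ (mul_pos h hm); have := mul_nonneg ha hp.le; linarith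
  -- Each marginal is a convex combination of `Qp / Zp` and `Qm / Zm`. The difference is thus
  -- exactly the change of the coefficient of `Qp / Zp`, bounded by `key`, times the influence.
  refine le_trans (le_of_eq ?_) (mul_le_mul_of_nonneg_right key (abs_nonneg _))
  rw [← abs_mul]
  congr 1
  have d1' : a * β * Zp + b * 1 * Zm ≠ 0 := by intro h; apply d1.ne'; linarith
  have d2' : a * 1 * Zp + b * γ * Zm ≠ 0 := by intro h; apply d2.ne'; linarith
  rw [div_sub_div _ _ d1' d2', div_sub_div _ _ hp.ne' hm.ne', div_mul_div_comm,
    div_eq_div_iff (mul_ne_zero d1' d2')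
      (mul_ne_zero (mul_ne_zero d1.ne' d2.ne') (mul_ne_zero hp.ne' hm.ne'))]
  ring

/-! ### Deletion of a vertex and the recursion for influences -/

/-- The neighbours of `w` in `S`. -/
def nbrs (S : Finset V) (w : V) : Finset V := S.filter (G.Adj w)

/-- The field obtained when the neighbours of `w` in `S` see the spin `1` at `w` if they are in `A`
and the spin `-1` otherwise. -/
def shiftField (β γ : ℝ) (S : Finset V) (φ : V → ℤˣ → ℝ) (w : V) (A : Finset V) :
    V → ℤˣ → ℝ := fun v t =>
  φ v t * if v ∈ nbrs G S w then pairWeight β γ (if v ∈ A then 1 else -1) t else 1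

lemma Admissible.shiftField (hβ : 0 < β) (hγ : 0 < γ) (S : Finset V) {φ : V → ℤˣ → ℝ}
    (hφ : Admissible φ) (w : V) (A : Finset V) : Admissible (shiftField G β γ S φ w A) := by
  intro v
  have : ∀ t, 0 < (if v ∈ nbrs G S w then
      pairWeight β γ (if v ∈ A then 1 else -1) t else 1) := by
    intro t
    by_cases h : v ∈ nbrs G S w
    · simpa only [h, if_true] using pairWeight_pos hβ hγ _ _
    · simp only [h, if_false, one_pos]
  refine ⟨fun t => mul_nonneg ((hφ v).1 t) (this t).le, ?_⟩
  obtain ⟨t, ht⟩ := (hφ v).2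
  exact ⟨t, mul_pos ht (this t)⟩

lemma prod_edges_peel (S : Finset V) {w : V} (hw : w ∈ S) (σ : V → ℤˣ) :
    ∏ e ∈ G.edgeFinset.filter (fun e => ∀ v ∈ e, v ∈ S), edgeWeight β γ σ e =
    (∏ v ∈ nbrs G S w, pairWeight β γ (σ w) (σ v)) *
    ∏ e ∈ G.edgeFinset.filter (fun e => ∀ v ∈ e, v ∈ S.erase w), edgeWeight β γ σ e := by
  have him : ∏ v ∈ nbrs G S w, pairWeight β γ (σ w) (σ v) =
      ∏ e ∈ (nbrs G S w).image (fun v => s(w, v)), edgeWeight β γ σ e := by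
    rw [Finset.prod_image fun a _ b _ hab => Sym2.congr_right.1 hab]
    rfl
  rw [him, ← Finset.prod_union]
  · congr 1
    ext e
    induction e with
    | _ a b =>
      simp only [nbrs, Finset.mem_filter, SimpleGraph.mem_edgeFinset, SimpleGraph.mem_edgeSet,
        Sym2.mem_iff, forall_eq_or_imp, forall_eq, Finset.mem_union, Finset.mem_image,
        Finset.mem_erase]
      constructor
      · rintro ⟨h, ha, hb⟩
        by_cases h1 : a = w
        · subst h1
          exact Or.inl ⟨b, ⟨hb, h⟩, rfl⟩
        by_cases h2 : b = w
        · subst h2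
          exact Or.inl ⟨a, ⟨ha, h.symm⟩, Sym2.eq_swap⟩
        exact Or.inr ⟨h, ⟨h1, ha⟩, h2, hb⟩
      · rintro (⟨v, ⟨hv, hwv⟩, he⟩ | ⟨h, ⟨_, ha⟩, _, hb⟩)
        · rcases Sym2.eq_iff.1 he with ⟨rfl, rfl⟩ | ⟨rfl, rfl⟩
          · exact ⟨hwv, hw, hv⟩
          · exact ⟨hwv.symm, hv, hw⟩
        · exact ⟨h, ha, hb⟩
  · rw [Finset.disjoint_left]
    intro e he he'
    obtain ⟨v, _, rfl⟩ := Finset.mem_image.1 he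
    have := (Finset.mem_filter.1 he').2 w (Sym2.mem_mk_left w v)
    simp at this

/-- With the spin of `w` fixed, the factor of each edge at `w` depends on one neighbour only and is
absorbed into its field. The deleted vertex stays as an isolated one. -/
lemma fieldWeight_peel (S : Finset V) {w : V} (hw : w ∈ S) (φ : V → ℤˣ → ℝ) (s : ℤˣ)
    (A : Finset V) (hA : ∀ v ∈ nbrs G S w, (if v ∈ A then 1 else -1 : ℤˣ) = s) (σ : V → ℤˣ) :
    fieldWeight G β γ S (Function.update φ w (pointField s)) σ =
    fieldWeight G β γ (S.erase w)
      (Function.update (shiftField G β γ S φ w A) w (pointField s)) σ := by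
  rw [fieldWeight_update, fieldWeight_update G (S.erase w) _ w (pointField s)]
  by_cases hs : σ w = s
  swap
  · simp [pointField, hs]
  congr 1
  unfold fieldWeight
  rw [prod_edges_peel G S hw, ← mul_assoc]
  congr 1
  rw [← Finset.mul_prod_erase _ _ (Finset.mem_univ w),
    ← Finset.mul_prod_erase _ (fun x => Function.update (shiftField G β γ S φ w A) w 1 x (σ x))
      (Finset.mem_univ w)]
  simp only [Function.update_self, Pi.one_apply, one_mul]
  have hsub : nbrs G S w ⊆ Finset.univ.erase w := by
    intro v hv
    rw [Finset.mem_erase]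
    exact ⟨(Finset.mem_filter.1 hv).2.ne', Finset.mem_univ _⟩
  have hD : ∏ v ∈ nbrs G S w, pairWeight β γ (σ w) (σ v) = ∏ v ∈ Finset.univ.erase w,
      if v ∈ nbrs G S w then pairWeight β γ (σ w) (σ v) else 1 :=
    Finset.prod_subset_one_on_sdiff hsub (fun v hv => if_neg (Finset.mem_sdiff.1 hv).2)
      fun v hv => (if_pos hv).symm
  rw [hD, ← Finset.prod_mul_distrib]
  refine Finset.prod_congr rfl fun v hv => ?_
  rw [Function.update_of_ne (Finset.ne_of_mem_erase hv),
    Function.update_of_ne (Finset.ne_of_mem_erase hv)]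
  unfold shiftField
  by_cases hv' : v ∈ nbrs G S w
  · simp only [hv', if_true, hA v hv', hs]
  · simp only [hv', if_false]

/-- The marginals do not depend on the spin of an isolated vertex. -/
lemma marginal_isolated (S : Finset V) {w u : V} (hw : w ∉ S) (hu : u ≠ w) (φ : V → ℤˣ → ℝ) :
    marginal G β γ S (Function.update φ w (pointField (-1))) u =
    marginal G β γ S (Function.update φ w (pointField 1)) u := by
  -- Flipping the spin at `w` exchanges the two point fields and preserves all other factors, since
  -- no interacting edge contains `w`.
  let flip : Equiv.Perm (V → ℤˣ) :=
    Function.Involutive.toPerm (fun σ => Function.update σ w (-σ w)) fun σ => by simp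
  have hflip : ∀ σ v, v ≠ w → flip σ v = σ v := fun σ v hv => Function.update_of_ne hv _ _
  have hflip' : ∀ σ, flip σ w = -σ w := fun σ => Function.update_self _ _ _
  have key : ∀ F : (V → ℤˣ) → ℝ, (∀ σ, F (flip σ) = F σ) →
      fieldSum G β γ S (Function.update φ w (pointField (-1))) F =
      fieldSum G β γ S (Function.update φ w (pointField 1)) F := by
    intro F hF
    unfold fieldSum
    rw [← Equiv.sum_comp flip]
    refine Finset.sum_congr rfl fun σ _ => ?_
    rw [hF, fieldWeight_update, fieldWeight_update G S φ w (pointField 1)]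
    congr 2
    · rw [hflip']
      simp [pointField, neg_inj]
    · unfold fieldWeight
      congr 1
      · refine Finset.prod_congr rfl fun v _ => ?_
        by_cases hv : v = w
        · subst hv; simp
        · rw [hflip σ v hv]
      · refine Finset.prod_congr rfl fun e he => ?_
        have he := (Finset.mem_filter.1 he).2
        induction e with
        | _ a b =>
          rw [edgeWeight_mk, edgeWeight_mk, hflip, hflip]
          · rintro rfl; exact hw (he _ (Sym2.mem_mk_right _ _))
          · rintro rfl; exact hw (he _ (Sym2.mem_mk_left _ _))
  unfold marginal
  rw [key _ fun σ => by rw [hflip σ u hu], key _ fun σ => rfl]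

/-- Together with `shiftField_update_self`, this presents the fields before and after switching `v`
as updates at `v` of one common field, the form that `abs_marginal_sub_le` needs. -/
lemma shiftField_insert (S : Finset V) (φ : V → ℤˣ → ℝ) (w : V) (A : Finset V) {v : V}
    (hv : v ∈ nbrs G S w) :
    shiftField G β γ S φ w (insert v A) = Function.update (shiftField G β γ S φ w A) v
      (fun t => φ v t * pairWeight β γ 1 t) := by
  funext x t
  by_cases hx : x = v
  · subst hx
    simp [shiftField, hv]
  · rw [Function.update_of_ne hx]
    simp [shiftField, hx]

lemma shiftField_update_self (S : Finset V) (φ : V → ℤˣ → ℝ) (w : V) {A : Finset V} {v : V}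
    (hv : v ∈ nbrs G S w) (hA : v ∉ A) :
    shiftField G β γ S φ w A = Function.update (shiftField G β γ S φ w A) v
      (fun t => φ v t * pairWeight β γ (-1) t) := by
  funext x t
  by_cases hx : x = v
  · subst hx
    simp [shiftField, hv, hA]
  · rw [Function.update_of_ne hx]

/-- Recursive bound of the influence of `w` by the influences of its neighbours after the deletion
of `w`. -/
lemma abs_fieldInfluence_le {δ : ℝ} (hβ : 0 < β) (hγ : 0 < γ) (hh : ∀ x, |hReal β γ x| ≤ δ)
    (S : Finset V) {φ : V → ℤˣ → ℝ} (hφ : Admissible φ) {w u : V} (hw : w ∈ S) (hu : u ≠ w)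
    {N : V → ℝ}
    (hN : ∀ v ∈ nbrs G S w, ∀ φ' : V → ℤˣ → ℝ, Admissible φ' →
      |fieldInfluence G β γ (S.erase w) φ' v u| ≤ N v) :
    |fieldInfluence G β γ S φ w u| ≤ δ * ∑ v ∈ nbrs G S w, N v := by
  have h0 : 0 ≤ δ := (abs_nonneg _).trans (hh 0)
  have peel : ∀ (s : ℤˣ) (A : Finset V),
      (∀ v ∈ nbrs G S w, (if v ∈ A then 1 else -1 : ℤˣ) = s) →
      marginal G β γ S (Function.update φ w (pointField s)) u = marginal G β γ (S.erase w)
        (Function.update (shiftField G β γ S φ w A) w (pointField s)) u := by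
    intro s A hA
    unfold marginal fieldSum
    simp only [fieldWeight_peel G S hw φ s A hA]
  unfold fieldInfluence
  -- All neighbours see $1$ on one side and $-1$ on the other; the spin of the isolated `w` is then
  -- made equal on both sides.
  rw [peel 1 (nbrs G S w) fun v hv => by simp [hv], peel (-1) ∅ fun v hv => by simp,
    marginal_isolated G (S.erase w) (by simp) hu]
  -- Interpolation: the neighbours in `A` have been switched, and the triangle inequality handles
  -- one more at a time.
  suffices H : ∀ A ⊆ nbrs G S w,
      |marginal G β γ (S.erase w)
          (Function.update (shiftField G β γ S φ w A) w (pointField 1)) u -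
        marginal G β γ (S.erase w)
          (Function.update (shiftField G β γ S φ w ∅) w (pointField 1)) u| ≤
      δ * ∑ v ∈ A, N v from H _ subset_rfl
  intro A
  induction A using Finset.induction with
  | empty => simp
  | insert v A hvA ih =>
    intro hA
    have hv : v ∈ nbrs G S w := hA (Finset.mem_insert_self _ _)
    have hvw : v ≠ w := (Finset.mem_filter.1 hv).2.ne'
    have ih := ih fun x hx => hA (Finset.mem_insert_of_mem hx)
    rw [Finset.sum_insert hvA, mul_add]
    refine (abs_sub_le _ (marginal G β γ (S.erase w)
      (Function.update (shiftField G β γ S φ w A) w (pointField 1)) u) _).trans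
      (add_le_add ?_ ih)
    have adm := (hφ.shiftField G hβ hγ S w A).update w 1
    rw [shiftField_insert G S φ w A hv, Function.update_comm hvw]
    nth_rw 2 [shiftField_update_self G S φ w hv hvA]
    rw [Function.update_comm hvw]
    exact (abs_marginal_sub_le G hβ hγ hh (S.erase w) adm v u (hφ v).1 (hφ v).2).trans
      (mul_le_mul_of_nonneg_left (hN v hv _ adm) h0)

lemma fieldInfluence_self (hβ : 0 < β) (hγ : 0 < γ) (S : Finset V) {φ : V → ℤˣ → ℝ}
    (hφ : Admissible φ) (u : V) : fieldInfluence G β γ S φ u u = 1 := by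
  have h1 : marginal G β γ S (Function.update φ u (pointField 1)) u = 1 := by
    unfold marginal
    rw [div_eq_one_iff_eq (fieldSum_pos G hβ hγ S (hφ.update u 1)).ne']
    unfold fieldSum
    refine Finset.sum_congr rfl fun σ _ => ?_
    rw [fieldWeight_update]
    by_cases hs : σ u = 1 <;> simp [hs, pointField]
  have h2 : marginal G β γ S (Function.update φ u (pointField (-1))) u = 0 := by
    unfold marginal
    rw [div_eq_zero_iff]
    left
    unfold fieldSum
    refine Finset.sum_eq_zero fun σ _ => ?_
    rw [fieldWeight_update]
    by_cases hs : σ u = 1 <;> simp [hs, pointField]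
  rw [fieldInfluence, h1, h2, sub_zero]

/-- Influences are bounded by any nonnegative supersolution of the non-backtracking recursion. -/
lemma abs_fieldInfluence_le_of_dart {δ : ℝ} (hβ : 0 < β) (hγ : 0 < γ)
    (hh : ∀ x, |hReal β γ x| ≤ δ) (u : V) (g : G.Dart → ℝ) (hg0 : ∀ e, 0 ≤ g e)
    (hg : ∀ e, g e = (if e.snd = u then 1 else 0) + δ * ∑ f, hashimoto G e f * g f)
    (S : Finset V) : ∀ (φ : V → ℤˣ → ℝ), Admissible φ → ∀ e : G.Dart, e.snd ∈ S → e.fst ∉ S →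
      |fieldInfluence G β γ S φ e.snd u| ≤ g e := by
  have h0 : 0 ≤ δ := (abs_nonneg _).trans (hh 0)
  have hH : ∀ e f, 0 ≤ hashimoto G e f := fun e f => by
    simp only [hashimoto, Matrix.of_apply]; split_ifs <;> norm_num
  induction S using Finset.strongInduction with
  | H S ih =>
  intro φ hφ e he1 he2
  by_cases hu : u = e.snd
  · rw [← hu, fieldInfluence_self G hβ hγ S hφ, abs_one, hg e, if_pos hu.symm]
    have := mul_nonneg h0 (Finset.sum_nonneg fun f (_ : f ∈ Finset.univ) =>
      mul_nonneg (hH e f) (hg0 f))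
    linarith
  · rw [hg e, if_neg (Ne.symm hu), zero_add]
    -- The bound for `v` is the value of `g` at the dart from `e.snd` to `v`; the default `0` is
    -- never used on a neighbour.
    refine (abs_fieldInfluence_le G hβ hγ hh S hφ (N := fun v => if h : G.Adj e.snd v then
      g ⟨(e.snd, v), h⟩ else 0) he1 hu ?_).trans (mul_le_mul_of_nonneg_left ?_ h0)
    · intro v hv φ' hφ'
      obtain ⟨hvS, hadj⟩ := Finset.mem_filter.1 hv
      simp only [hadj, dif_pos]
      exact ih (S.erase e.snd) (Finset.erase_ssubset he1) φ' hφ' ⟨(e.snd, v), hadj⟩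
        (Finset.mem_erase.2 ⟨hadj.ne', hvS⟩) (by simp)
    · calc ∑ v ∈ nbrs G S e.snd, (if h : G.Adj e.snd v then g ⟨(e.snd, v), h⟩ else 0)
          = ∑ v ∈ (nbrs G S e.snd).attach,
              g ⟨(e.snd, v.1), (Finset.mem_filter.1 v.2).2⟩ := by
            rw [← Finset.sum_attach]
            refine Finset.sum_congr rfl fun v _ => ?_
            rw [dif_pos (Finset.mem_filter.1 v.2).2]
        _ = ∑ f ∈ (nbrs G S e.snd).attach.image
              (fun v => (⟨(e.snd, v.1), (Finset.mem_filter.1 v.2).2⟩ : G.Dart)), g f := by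
            rw [Finset.sum_image]
            intro a _ b _ hab
            simp only [SimpleGraph.Dart.mk.injEq, Prod.mk.injEq] at hab
            exact Subtype.ext hab.2
        _ = ∑ f ∈ (nbrs G S e.snd).attach.image
              (fun v => (⟨(e.snd, v.1), (Finset.mem_filter.1 v.2).2⟩ : G.Dart)),
              hashimoto G e f * g f := by
            refine Finset.sum_congr rfl fun f hf => ?_
            obtain ⟨v, _, rfl⟩ := Finset.mem_image.1 hf
            -- The tail of `e` lies outside `S`, so a step to a neighbour in `S` cannot backtrack.
            have : e.fst ≠ v.1 := by
              intro h
              exact he2 (h ▸ (Finset.mem_filter.1 v.2).1)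
            simp [hashimoto, this]
        _ ≤ ∑ f, hashimoto G e f * g f :=
            Finset.sum_le_sum_of_subset_of_nonneg (Finset.subset_univ _)
              fun f _ _ => mul_nonneg (hH e f) (hg0 f)

end

/-! ### Nonnegative matrices and spectral radii -/

section Resolvent

variable {n : Type*} [Fintype n] [DecidableEq n]

attribute [local instance] Matrix.linftyOpNormedRing Matrix.linftyOpNormedAlgebra

open Filter Topology ENNReal in
-- Gelfand's formula over $\mathbb C$: for `r` slightly above the spectral radius the powers are
-- eventually bounded by $r^k$. The row-sum norm is the same for a real matrix and its
-- complexification.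
lemma summable_pow_of_rho (B : Matrix n n ℝ) {δ : ℝ} (hδ : 0 ≤ δ) (h : δ * rho B < 1) :
    Summable fun k : ℕ => (δ • B) ^ k := by
  set C : Matrix n n ℂ := B.map ((↑) : ℝ → ℂ) with hC
  have : CompleteSpace (Matrix n n ℂ) := FiniteDimensional.complete ℂ _
  have : CompleteSpace (Matrix n n ℝ) := FiniteDimensional.complete ℝ _
  have hnorm : ∀ k : ℕ, ‖C ^ k‖ = ‖B ^ k‖ := by
    intro k
    have : C ^ k = (B ^ k).map ((↑) : ℝ → ℂ) :=
      (map_pow (Complex.ofRealHom.mapMatrix (m := n)) B k).symm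
    rw [this, Matrix.linfty_opNorm_def, Matrix.linfty_opNorm_def]
    simp
  obtain ⟨r, hr, hδr⟩ : ∃ r, rho B < r ∧ δ * r < 1 := by
    rcases hδ.eq_or_lt with rfl | hδ
    · exact ⟨rho B + 1, by linarith, by simp⟩
    · have : rho B < δ⁻¹ := by rwa [← one_div, lt_div_iff₀' hδ]
      obtain ⟨r, h1, h2⟩ := exists_between this
      exact ⟨r, h1, by rwa [← lt_div_iff₀' hδ, one_div]⟩
  have hr0 : 0 ≤ r := (ENNReal.toReal_nonneg.trans_lt hr).le
  -- Finiteness is needed because `rho` is defined through `toReal`, which sends `⊤` to `0`.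
  have htop : spectralRadius ℂ C ≠ ⊤ := by
    refine ne_top_of_le_ne_top ?_ (spectrum.spectralRadius_le_pow_nnnorm_pow_one_div ℂ C 0)
    simp [ENNReal.mul_eq_top]
  have ht := (spectrum.pow_norm_pow_one_div_tendsto_nhds_spectralRadius C).eventually
    (gt_mem_nhds ((ENNReal.lt_ofReal_iff_toReal_lt htop).2 hr))
  refine Summable.of_norm_bounded_eventually_nat
    (summable_geometric_of_lt_one (mul_nonneg hδ hr0) hδr) ?_
  filter_upwards [ht, eventually_ge_atTop 1] with k hk hk1
  rw [smul_pow, norm_smul, mul_pow, norm_pow, Real.norm_of_nonneg hδ, ← hnorm]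
  refine mul_le_mul_of_nonneg_left ?_ (pow_nonneg hδ k)
  have hk := (ENNReal.ofReal_lt_ofReal_iff_of_nonneg (by positivity)).1 hk
  have hk0 : (k : ℝ) ≠ 0 := by positivity
  calc ‖C ^ k‖ = (‖C ^ k‖ ^ (1 / k : ℝ)) ^ k := by
        rw [← Real.rpow_natCast, ← Real.rpow_mul (norm_nonneg _), one_div_mul_cancel hk0,
          Real.rpow_one]
    _ ≤ r ^ k := pow_le_pow_left₀ (by positivity) hk.le k

/-- Neumann series of a nonnegative matrix. -/
lemma exists_nonneg_resolvent (B : Matrix n n ℝ) (hB : ∀ i j, 0 ≤ B i j) {δ : ℝ} (hδ : 0 ≤ δ)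
    (h : δ * rho B < 1) :
    ∃ N : Matrix n n ℝ, (∀ i j, 0 ≤ N i j) ∧ N = 1 + δ • (B * N) := by
  have : CompleteSpace (Matrix n n ℝ) := FiniteDimensional.complete ℝ _
  have hs := summable_pow_of_rho B hδ h
  refine ⟨∑' k : ℕ, (δ • B) ^ k, fun i j => ?_, ?_⟩
  · have hpow : ∀ k : ℕ, ∀ i j, 0 ≤ ((δ • B) ^ k) i j := by
      intro k
      induction k with
      | zero =>
        intro i j
        rw [pow_zero, Matrix.one_apply]
        split_ifs <;> norm_num
      | succ k ih =>
        intro i j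
        rw [pow_succ, Matrix.mul_apply]
        exact Finset.sum_nonneg fun l _ => mul_nonneg (ih i l) (mul_nonneg hδ (hB l j))
    have := Pi.hasSum.1 (Pi.hasSum.1 hs.hasSum i) j
    exact this.nonneg fun k => hpow k i j
  · have := hs.one_sub_mul_tsum_pow
    rw [sub_mul, one_mul, sub_eq_iff_eq_add, Matrix.smul_mul] at this
    exact this

end Resolvent

/-- The spectral radius of a matrix is at most the Euclidean norm of any matrix that dominates it
entrywise. -/
lemma rho_le_norm2 {n m : Type*} [Fintype n] [DecidableEq n] [Fintype m] [DecidableEq m]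
    (i : m → n) (hi : Function.Injective i) (M : Matrix m m ℝ) (P : Matrix n n ℝ)
    (hM : ∀ a b, |M a b| ≤ P (i a) (i b)) : rho M ≤ norm2 P := by
  have hn : 0 ≤ norm2 P := norm_nonneg _
  unfold rho
  refine ENNReal.toReal_le_of_le_ofReal hn ?_
  unfold spectralRadius
  refine iSup₂_le fun μ hμ => ?_
  rw [← enorm_eq_nnnorm, ← ofReal_norm]
  refine ENNReal.ofReal_le_ofReal ?_
  rw [← Matrix.spectrum_toLin', ← Module.End.hasEigenvalue_iff_mem_spectrum] at hμ
  obtain ⟨x, hx⟩ := hμ.exists_hasEigenvector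
  have hx1 := hx.apply_eq_smul
  have hx0 := hx.2
  rw [Matrix.toLin'_apply] at hx1
  -- The moduli of the eigenvector, extended by zero, satisfy $|\mu|\,y \le Py$ on the range of `i`.
  -- Elsewhere $y = 0$, so the comparison of squares needs no sign of $Py$ there.
  let y : n → ℝ := Function.extend i (fun a => ‖x a‖) 0
  have hy : ∀ a, y (i a) = ‖x a‖ := fun a => hi.extend_apply _ _ _
  have hy' : ∀ b, b ∉ Set.range i → y b = 0 := fun b hb => Function.extend_apply' _ _ _ hb
  have hsum : ∀ F : n → ℝ, (∀ b, b ∉ Set.range i → F b = 0) → ∑ b, F b = ∑ a, F (i a) := by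
    intro F hF
    exact (Fintype.sum_of_injective i hi _ _ hF fun _ => rfl).symm
  have hbound : ∀ a, ‖μ‖ * ‖x a‖ ≤ (P.mulVec y) (i a) := by
    intro a
    rw [← norm_mul, ← smul_eq_mul, ← Pi.smul_apply, ← hx1, Matrix.mulVec, dotProduct,
      Matrix.mulVec, dotProduct, hsum _ fun b hb => by rw [hy' b hb, mul_zero]]
    refine (norm_sum_le _ _).trans (Finset.sum_le_sum fun b _ => ?_)
    rw [norm_mul, hy, Matrix.map_apply, Complex.norm_real, Real.norm_eq_abs]
    exact mul_le_mul_of_nonneg_right (hM a b) (norm_nonneg _)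
  let Y : EuclideanSpace ℝ n := WithLp.toLp 2 y
  have hY : 0 < ‖Y‖ := by
    rw [norm_pos_iff]
    intro h
    apply hx0
    funext a
    have : y (i a) = 0 := congrFun (congrArg WithLp.ofLp h) (i a)
    rw [hy] at this
    simpa using this
  have hle := (Matrix.toEuclideanCLM (𝕜 := ℝ) P).le_opNorm Y
  have hlow : ‖μ‖ * ‖Y‖ ≤ ‖Matrix.toEuclideanCLM (𝕜 := ℝ) P Y‖ := by
    refine le_of_sq_le_sq ?_ (norm_nonneg _)
    rw [mul_pow, EuclideanSpace.norm_sq_eq, EuclideanSpace.norm_sq_eq, Matrix.toEuclideanCLM_toLp,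
      Finset.mul_sum]
    refine Finset.sum_le_sum fun b _ => ?_
    simp only [Y, Real.norm_eq_abs, sq_abs]
    by_cases hb : b ∈ Set.range i
    · obtain ⟨a, rfl⟩ := hb
      rw [hy, ← mul_pow]
      exact pow_le_pow_left₀ (by positivity) (hbound a) 2
    · rw [hy' b hb]
      nlinarith [sq_nonneg ((P.mulVec y) b)]
  exact le_of_mul_le_mul_right (hlow.trans hle) hY

/-! ### Non-backtracking walks and the Ihara matrix -/

section Ihara

variable {V : Type*} [Fintype V] [DecidableEq V] (G : SimpleGraph V) [DecidableRel G.Adj]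

lemma sum_dart_fst (w : V) (F : V → ℝ) :
    ∑ e : G.Dart with e.fst = w, F e.snd = ∑ v ∈ G.neighborFinset w, F v := by
  refine Finset.sum_bij' (fun e _ => e.snd)
    (fun v hv => ⟨(w, v), (G.mem_neighborFinset w v).1 hv⟩) ?_ ?_ ?_ ?_ ?_
  · intro e he
    rw [SimpleGraph.mem_neighborFinset]
    exact (Finset.mem_filter.1 he).2 ▸ e.adj
  · intro v hv
    simp
  · intro e he
    ext
    · exact (Finset.mem_filter.1 he).2.symm
    · rfl
  · intro v hv
    rfl
  · intro e he
    rfl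

/-- Among the darts leaving `e.snd`, the non-backtracking condition excludes exactly `e.symm`. -/
lemma sum_hashimoto (g : G.Dart → ℝ) (e : G.Dart) :
    ∑ f, hashimoto G e f * g f = ∑ f : G.Dart with f.fst = e.snd, g f - g e.symm := by
  have hmem : e.symm ∈ (Finset.univ : Finset G.Dart).filter (fun f => f.fst = e.snd) := by simp
  rw [← Finset.add_sum_erase _ _ hmem, add_sub_cancel_left]
  simp only [hashimoto, Matrix.of_apply, ite_mul, one_mul, zero_mul]
  rw [← Finset.sum_filter]
  refine Finset.sum_congr ?_ fun _ _ => rfl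
  ext f
  simp only [Finset.mem_filter, Finset.mem_univ, true_and, Finset.mem_erase]
  constructor
  · rintro ⟨h1, h2⟩
    refine ⟨?_, h1.symm⟩
    rintro rfl
    exact h2 rfl
  · rintro ⟨h1, h2⟩
    refine ⟨h2.symm, fun h => h1 ?_⟩
    ext
    · exact h2
    · exact h.symm

/-- The generating function of the non-backtracking walks, from that of the walks with a given first
oriented edge. -/
def walkMatrix (δ : ℝ) (g : G.Dart → V → ℝ) : Matrix V V ℝ :=
  Matrix.of fun w u => (if w = u then 1 else 0) + δ * ∑ e : G.Dart with e.fst = w, g e u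

/-- The Ihara–Bass identity. -/
lemma iharaMatrix_mul_walkMatrix {δ : ℝ} (g : G.Dart → V → ℝ)
    (hg : ∀ e u, g e u = (if e.snd = u then 1 else 0) + δ * ∑ f, hashimoto G e f * g f u) :
    iharaMatrix G δ * walkMatrix G δ g = (1 - δ ^ 2) • 1 := by
  -- Walks starting with `e` continue by any walk from `e.snd`, minus those whose first step is the
  -- reversal of `e`.
  have h1 : ∀ e u, g e u = walkMatrix G δ g e.snd u - δ * g e.symm u := by
    intro e u
    rw [hg, sum_hashimoto G (fun f => g f u), walkMatrix, Matrix.of_apply]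
    ring
  -- Using `h1` for `e` and for its reversal eliminates the reversed term; this produces the factor
  -- $1-\delta^2$.
  have h2 : ∀ e u, (1 - δ ^ 2) * g e u =
      walkMatrix G δ g e.snd u - δ * walkMatrix G δ g e.fst u := by
    intro e u
    have ha := h1 e u
    have hb := h1 e.symm u
    rw [SimpleGraph.Dart.symm_symm] at hb
    have hc : e.symm.snd = e.fst := rfl
    rw [hc] at hb
    linear_combination ha - δ * hb
  ext w u
  have h3 : (1 - δ ^ 2) * ∑ e : G.Dart with e.fst = w, g e u =
      ∑ v ∈ G.neighborFinset w, walkMatrix G δ g v u -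
        δ * (G.degree w * walkMatrix G δ g w u) := by
    rw [Finset.mul_sum, ← sum_dart_fst G w fun v => walkMatrix G δ g v u,
      ← G.dart_fst_fiber_card_eq_degree w, ← nsmul_eq_mul, ← Finset.sum_const, Finset.mul_sum,
      ← Finset.sum_sub_distrib]
    refine Finset.sum_congr rfl fun e he => ?_
    rw [h2, (Finset.mem_filter.1 he).2]
  have h4 : walkMatrix G δ g w u =
      (1 : Matrix V V ℝ) w u + δ * ∑ e : G.Dart with e.fst = w, g e u := by
    rw [walkMatrix, Matrix.of_apply, Matrix.one_apply]
  have h5 : (iharaMatrix G δ * walkMatrix G δ g) w u = walkMatrix G δ g w u -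
      δ * ∑ v ∈ G.neighborFinset w, walkMatrix G δ g v u +
      δ ^ 2 * (G.degree w * walkMatrix G δ g w u - walkMatrix G δ g w u) := by
    simp only [iharaMatrix, add_mul, sub_mul, one_mul, Matrix.smul_mul, Matrix.add_apply,
      Matrix.sub_apply, Matrix.smul_apply, smul_eq_mul, SimpleGraph.adjMatrix_mul_apply,
      SimpleGraph.degMatrix, Matrix.diagonal_mul]
  rw [h5, Matrix.smul_apply, smul_eq_mul]
  linear_combination (1 - δ ^ 2) * h4 + δ * h3

end Ihara

/-! ### The influence matrix -/

lemma Contraction.abs_h_le {δ β γ lam : ℝ} {Δ : ℕ} (hc : Contraction δ Δ β γ lam) (hΔ : 1 ≤ Δ)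
    (hβ : 0 ≤ β) (hγ : 0 < γ) (y : EReal) : |h β γ y| ≤ δ := by
  have := hc 1 le_rfl hΔ fun _ => y
  rw [grad_eq hβ hγ] at this
  exact (norm_le_pi_norm (fun _ : Fin 1 => h β γ y) 0).trans this

section

variable {V : Type*} [Fintype V] [DecidableEq V] (G : SimpleGraph V) [DecidableRel G.Adj]
variable {β γ lam : ℝ}

open Classical in
/-- The external field of the Gibbs distribution conditioned on the spins in `Λ`. -/
def pinnedField (lam : ℝ) (Λ : Finset V) (τ : Λ → ℤˣ) (v : V) (t : ℤˣ) : ℝ :=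
  (if t = 1 then lam else 1) * if ∀ hv : v ∈ Λ, t = τ ⟨v, hv⟩ then 1 else 0

lemma admissible_pinnedField (hlam : 0 < lam) (Λ : Finset V) (τ : Λ → ℤˣ) :
    Admissible (pinnedField lam Λ τ) := by
  have h1 : ∀ t : ℤˣ, 0 < if t = 1 then lam else 1 := fun t => by
    split_ifs
    · exact hlam
    · exact one_pos
  intro v
  refine ⟨fun t => mul_nonneg (h1 t).le (by split_ifs <;> norm_num), ?_⟩
  by_cases hv : v ∈ Λ
  · exact ⟨τ ⟨v, hv⟩, mul_pos (h1 _) (by simp)⟩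
  · exact ⟨1, mul_pos (h1 _) (by simp [hv])⟩

lemma weight_eq (σ : V → ℤˣ) :
    weight G β γ lam σ = (∏ v, if σ v = 1 then lam else 1) *
      ∏ e ∈ G.edgeFinset, edgeWeight β γ σ e := by
  unfold weight
  rw [mul_assoc, ← Finset.prod_const lam, ← Finset.prod_const β, ← Finset.prod_const γ,
    Finset.prod_filter, Finset.prod_filter, Finset.prod_filter, ← Finset.prod_mul_distrib]
  congr 1
  refine Finset.prod_congr rfl fun e _ => ?_
  induction e with
  | _ a b =>
    rw [edgeWeight_mk]
    rcases Int.units_eq_one_or (σ a) with ha | ha <;>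
      rcases Int.units_eq_one_or (σ b) with hb | hb <;> simp [ha, hb, pairWeight]

lemma weight_pos (hβ : 0 < β) (hγ : 0 < γ) (hlam : 0 < lam) (σ : V → ℤˣ) :
    0 < weight G β γ lam σ := by
  unfold weight
  positivity

lemma fieldWeight_pinnedField (Λ : Finset V) (τ : Λ → ℤˣ) (σ : V → ℤˣ) :
    fieldWeight G β γ Finset.univ (pinnedField lam Λ τ) σ =
      if σ ∈ pinned Λ τ then weight G β γ lam σ else 0 := by
  classical
  have hprod : ∏ v, (if ∀ hv : v ∈ Λ, σ v = τ ⟨v, hv⟩ then (1 : ℝ) else 0) =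
      if σ ∈ pinned Λ τ then 1 else 0 := by
    rw [Finset.prod_boole]
    simp [pinned]
  simp only [fieldWeight, pinnedField, Finset.prod_mul_distrib, Finset.mem_univ, implies_true,
    Finset.filter_true]
  rw [hprod, weight_eq]
  split_ifs <;> ring

/-- The factor `lam` or `1` is the field of the unpinned vertex `w`, which the point field replaces.
It cancels in conditional probabilities. -/
lemma pinned_weight_eq (Λ : Finset V) (τ : Λ → ℤˣ) {w : V} (hw : w ∉ Λ) (s : ℤˣ) (σ : V → ℤˣ) :
    (if σ ∈ pinned Λ τ ∩ spinAt w s then weight G β γ lam σ else 0) =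
    (if s = 1 then lam else 1) * fieldWeight G β γ Finset.univ
      (Function.update (pinnedField lam Λ τ) w (pointField s)) σ := by
  rw [fieldWeight_update]
  by_cases hs : σ w = s
  · have h1 : pinnedField lam Λ τ w (σ w) = if s = 1 then lam else 1 := by
      simp [pinnedField, hw, hs]
    have h2 : pointField s (σ w) = 1 := by simp [pointField, hs]
    rw [h2, one_mul, ← h1, ← fieldWeight_update, Function.update_eq_self, fieldWeight_pinnedField]
    simp [spinAt, hs]
  · simp [spinAt, pointField, hs]

lemma condProb_eq (hβ : 0 < β) (hγ : 0 < γ) (hlam : 0 < lam) (Λ : Finset V) (τ : Λ → ℤˣ)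
    {w : V} (hw : w ∉ Λ) (s : ℤˣ) (u : V) :
    condProb G β γ lam (spinAt u 1) (pinned Λ τ ∩ spinAt w s) =
    marginal G β γ Finset.univ (Function.update (pinnedField lam Λ τ) w (pointField s)) u := by
  have hZ : 0 < ∑ σ : V → ℤˣ, weight G β γ lam σ :=
    Finset.sum_pos (fun σ _ => weight_pos G hβ hγ hlam σ) Finset.univ_nonempty
  have hc : (if s = 1 then lam else 1) ≠ 0 := by
    split_ifs
    · exact hlam.ne'
    · exact one_ne_zero
  have hden : ∑ σ ∈ pinned Λ τ ∩ spinAt w s, weight G β γ lam σ = (if s = 1 then lam else 1) *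
      fieldSum G β γ Finset.univ (Function.update (pinnedField lam Λ τ) w (pointField s)) 1 := by
    unfold fieldSum
    rw [← Finset.univ_inter (_ ∩ _), ← Finset.sum_ite_mem, Finset.mul_sum]
    refine Finset.sum_congr rfl fun σ _ => ?_
    rw [pinned_weight_eq G Λ τ hw, Pi.one_apply, mul_one]
  have hnum : ∑ σ ∈ spinAt u 1 ∩ (pinned Λ τ ∩ spinAt w s), weight G β γ lam σ =
      (if s = 1 then lam else 1) * fieldSum G β γ Finset.univ
        (Function.update (pinnedField lam Λ τ) w (pointField s))
        (fun σ => if σ u = 1 then 1 else 0) := by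
    unfold fieldSum
    rw [← Finset.univ_inter (_ ∩ _), ← Finset.sum_ite_mem, Finset.mul_sum]
    refine Finset.sum_congr rfl fun σ _ => ?_
    rw [← mul_assoc, ← pinned_weight_eq G Λ τ hw]
    by_cases hu : σ u = 1
    · simp [spinAt, hu]
    · simp [spinAt, hu]
  unfold condProb gibbs marginal
  rw [← Finset.sum_div, ← Finset.sum_div, div_div_div_cancel_right₀ hZ.ne', hnum, hden,
    mul_div_mul_left _ _ hc]

lemma influence_eq (hβ : 0 < β) (hγ : 0 < γ) (hlam : 0 < lam) (Λ : Finset V) (τ : Λ → ℤˣ)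
    (w u : {v : V // v ∉ Λ}) : influence G β γ lam Λ τ w u =
      fieldInfluence G β γ Finset.univ (pinnedField lam Λ τ) w u := by
  rw [influence, Matrix.of_apply, condProb_eq G hβ hγ hlam Λ τ w.2,
    condProb_eq G hβ hγ hlam Λ τ w.2, fieldInfluence]

/-- Influences are bounded by the generating function of the non-backtracking walks. -/
lemma abs_fieldInfluence_le_walkMatrix {δ : ℝ} (hβ : 0 < β) (hγ : 0 < γ)
    (hh : ∀ x, |hReal β γ x| ≤ δ) (g : G.Dart → V → ℝ) (hg0 : ∀ e u, 0 ≤ g e u)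
    (hg : ∀ e u, g e u = (if e.snd = u then 1 else 0) + δ * ∑ f, hashimoto G e f * g f u)
    {φ : V → ℤˣ → ℝ} (hφ : Admissible φ) (w u : V) :
    |fieldInfluence G β γ Finset.univ φ w u| ≤ walkMatrix G δ g w u := by
  have h0 : 0 ≤ δ := (abs_nonneg _).trans (hh 0)
  rw [walkMatrix, Matrix.of_apply]
  by_cases hu : u = w
  · subst hu
    rw [fieldInfluence_self G hβ hγ _ hφ, abs_one, if_pos rfl]
    have := mul_nonneg h0 (Finset.sum_nonneg fun e (_ : e ∈
      (Finset.univ : Finset G.Dart).filter (fun e => e.fst = u)) => hg0 e u)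
    linarith
  · rw [if_neg (Ne.symm hu), zero_add]
    have hset : nbrs G Finset.univ w = G.neighborFinset w := by
      ext v; simp [nbrs]
    -- The first step has no predecessor, so all neighbours of `w` count; the dart bound applies
    -- once `w` is deleted.
    refine (abs_fieldInfluence_le G hβ hγ hh _ hφ (N := fun v => if h : G.Adj w v then
      g ⟨(w, v), h⟩ u else 0) (Finset.mem_univ w) hu ?_).trans (le_of_eq ?_)
    · intro v hv φ' hφ'
      have hadj : G.Adj w v := (Finset.mem_filter.1 hv).2
      simp only [hadj, dif_pos]
      exact abs_fieldInfluence_le_of_dart G hβ hγ hh u (fun e => g e u) (fun e => hg0 e u)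
        (fun e => hg e u) _ φ' hφ' ⟨(w, v), hadj⟩ (by simp [hadj.ne']) (by simp)
    · rw [hset, ← sum_dart_fst]
      congr 1
      refine Finset.sum_congr rfl fun e he => ?_
      obtain rfl := (Finset.mem_filter.1 he).2
      exact dif_pos e.adj

end

end TwoSpin

end

/-! ### Proof of the spectral bound -/

theorem theorem5p3 {V : Type*} [Fintype V] [DecidableEq V] (G : SimpleGraph V)
    [DecidableRel G.Adj] (Δ : ℕ) (ν ε β γ lam : ℝ)
    (hΔ : 1 ≤ Δ) (hν : 1 ≤ ν) (hε : ε ∈ Set.Ioo (0 : ℝ) 1)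
    (hβ : 0 ≤ β) (hβγ : β ≤ γ) (hγ : 0 < γ) (hlam : 0 < lam)
    (hdeg : G.maxDegree = Δ) (hrad : TwoSpin.rho (TwoSpin.hashimoto G) = ν)
    (hcontr : TwoSpin.Contraction ((1 - ε) / ν) Δ β γ lam) :
    IsUnit (TwoSpin.iharaMatrix G ((1 - ε) / ν)) ∧
    ∀ (Λ : Finset V) (τ : Λ → ℤˣ),
      TwoSpin.rho (TwoSpin.influence G β γ lam Λ τ) ≤
        TwoSpin.norm2 ((TwoSpin.iharaMatrix G ((1 - ε) / ν))⁻¹) := by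
  have hν0 : 0 < ν := one_pos.trans_le hν
  have hδρ : (1 - ε) / ν * TwoSpin.rho (TwoSpin.hashimoto G) < 1 := by
    rw [hrad, div_mul_cancel₀ _ hν0.ne']
    linarith [hε.1]
  have hδ1 : (1 - ε) / ν < 1 := by
    rw [div_lt_one hν0]
    linarith [hε.1]
  have hδ0 : 0 ≤ (1 - ε) / ν := div_nonneg (by linarith [hε.2]) hν0.le
  generalize (1 - ε) / ν = δ at *
  have hh := hcontr.abs_h_le hΔ hβ hγ
  -- If $\beta = 0$, then $h(+\infty) = -1$, which contradicts $\delta < 1$.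
  have hβ0 : 0 < β := by
    refine hβ.lt_of_ne' fun h0 => ?_
    have := hh ⊤
    have htop : TwoSpin.h β γ ⊤ = -1 := if_pos h0
    rw [htop, abs_neg, abs_one] at this
    linarith
  have hh' : ∀ x, |TwoSpin.hReal β γ x| ≤ δ := fun x => hh x
  obtain ⟨N, hN0, hN⟩ := TwoSpin.exists_nonneg_resolvent (TwoSpin.hashimoto G)
    (fun e f => by simp only [TwoSpin.hashimoto, Matrix.of_apply]; split_ifs <;> norm_num) hδ0 hδρ
  let R : Matrix G.Dart V ℝ := Matrix.of fun e u => if e.snd = u then 1 else 0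
  -- The resolvent applied to the indicator of the final vertex solves the walk recursion.
  let g : Matrix G.Dart V ℝ := N * R
  have hg0 : ∀ e u, 0 ≤ g e u := fun e u => by
    change 0 ≤ (N * R) e u
    rw [Matrix.mul_apply]
    refine Finset.sum_nonneg fun f _ => mul_nonneg (hN0 e f) ?_
    simp only [R, Matrix.of_apply]
    split_ifs <;> norm_num
  have hg : ∀ e u, g e u = (if e.snd = u then 1 else 0) +
      δ * ∑ f, TwoSpin.hashimoto G e f * g f u := by
    intro e u
    have : g = R + δ • (TwoSpin.hashimoto G * g) := by
      change N * R = R + δ • (TwoSpin.hashimoto G * (N * R))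
      nth_rw 1 [hN]
      rw [Matrix.add_mul, Matrix.one_mul, Matrix.smul_mul, Matrix.mul_assoc]
    exact congrFun (congrFun this e) u
  have hIB := TwoSpin.iharaMatrix_mul_walkMatrix G g hg
  have hδ2 : 0 < 1 - δ ^ 2 := by nlinarith
  have hinv : TwoSpin.iharaMatrix G δ * ((1 - δ ^ 2)⁻¹ • TwoSpin.walkMatrix G δ g) = 1 := by
    rw [Matrix.mul_smul, hIB, smul_smul, inv_mul_cancel₀ hδ2.ne', one_smul]
  refine ⟨(Matrix.isUnit_iff_isUnit_det _).2 (Matrix.isUnit_det_of_right_inverse hinv),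
    fun Λ τ => ?_⟩
  rw [Matrix.inv_eq_right_inv hinv]
  refine TwoSpin.rho_le_norm2 Subtype.val Subtype.val_injective _ _ fun w u => ?_
  rw [TwoSpin.influence_eq G hβ0 hγ hlam]
  have hb := TwoSpin.abs_fieldInfluence_le_walkMatrix G hβ0 hγ hh' g hg0 hg
    (TwoSpin.admissible_pinnedField hlam Λ τ) w.1 u.1
  refine hb.trans ?_
  rw [Matrix.smul_apply, smul_eq_mul]
  -- The inverse is $(1-\delta^2)^{-1}W$ with nonnegative entries of $W$ and $(1-\delta^2)^{-1} \ge
  -- 1$, so it dominates $W$.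
  exact le_mul_of_one_le_left ((abs_nonneg _).trans hb)
    ((one_le_inv₀ hδ2).2 (by nlinarith [sq_nonneg δ]))
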